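/- Let $d\ge 1$ be an integer. For a noncrossing partition $\pi$ of $[n]=\{1,\dots,n\}$ let $\pi'$ be its Kreweras dual: place $1,1',2,2',\dots,n,n'$ in this order on a circle; $\pi'$ is the partition of $\{1',\dots,n'\}$ in which $i'$ and $j'$ are in the same block if and only if no convex hull of a block of $\pi$ separates them. Let $\mathrm{NC}^d_n$ be the set of noncrossing partitions $\pi$ of $[n]$ such that all blocks of $\pi$ and of $\pi'$ have cardinality congruent to $1$ modulo $d$. Write $|\pi|$ for the number of blocks of $\pi$. Let $R$ be a commutative ring, let $s,t\in R$ (for instance indeterminates), and let $(a(k))_{k\ge 0}$ and $(a^*(k))_{k\ge 0}$ be sequences in $R$ with $a(0)=a^*(0)=1$. For $\pi\in\mathrm{NC}^d_{dk+1}$ put $$\mathrm{wt}(\pi)=\prod_{B\in\pi}a\!\left(\tfrac{|B|-1}{d}\right)\cdot\prod_{C'\in\pi'}a^*\!\left(\tfrac{|C'|-1}{d}\right)\cdot s^{(|\pi|-1)/d}\cdot t^{(|\pi'|-1)/d},$$ where the exponents of $s$ and $t$ are the corank and the rank of $\pi$ in $\mathrm{NC}^d_{dk+1}$, ordered by refinement.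 Define the formal power series $A(x)=\sum_{k\ge0}a(k)x^k$, $A^*(x)=\sum_{k\ge0}a^*(k)x^k$ and $$B(x)=\sum_{k\ge0}\Bigl(\sum_{\pi\in\mathrm{NC}^d_{dk+1}}\mathrm{wt}(\pi)\Bigr)x^k,\quad C(x)=\sum_{k\ge0}\Bigl(\sum_{\substack{\pi\in\mathrm{NC}^d_{dk+1}\\ \{1\}\in\pi}}\mathrm{wt}(\pi)\Bigr)x^k,\quad C^*(x)=\sum_{k\ge0}\Bigl(\sum_{\substack{\pi\in\mathrm{NC}^d_{dk+1}\\ \{1'\}\in\pi'}}\mathrm{wt}(\pi)\Bigr)x^k .$$ Then, in $R[[x]]$, $$C(x)=A^*\bigl(x\,s\,C^*(x)^d\bigr),\qquad C^*(x)=A\bigl(x\,t\,C(x)^d\bigr),\qquad B(x)=C(x)\,C^*(x).$$ Furthermore, the first two equations determine $C$ and $C^*$ uniquely: if $F,G\in R[[x]]$ satisfy $F(x)=A^*(x\,s\,G(x)^d)$ and $G(x)=A(x\,t\,F(x)^d)$, then $F=C$ and $G=C^*$. -/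

import Mathlib

namespace IndivisibleNC

open Finset

/-- A partition of `Fin n` (the element `i : Fin n` stands for `i + 1 ∈ [n]`) is noncrossing if
no two different blocks `B`, `C` have `i < j < k < l` with `i, k ∈ B` and `j, l ∈ C`. -/
def IsNoncrossing {n : ℕ} (π : Finpartition (univ : Finset (Fin n))) : Prop :=
  ∀ B ∈ π.parts, ∀ C ∈ π.parts, B ≠ C →
    ¬ ∃ i ∈ B, ∃ j ∈ C, ∃ k ∈ B, ∃ l ∈ C, i < j ∧ j < k ∧ k < l

instance {n : ℕ} (π : Finpartition (univ : Finset (Fin n))) : Decidable (IsNoncrossing π) := by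
  unfold IsNoncrossing; infer_instance

/-- In the cyclic order `1 < 1' < 2 < 2' < ⋯ < n < n' < 1` the chord joining `i'` and `j'` cuts
the vertices `1, …, n` into two arcs. This is the arc that does not contain `1`: the vertices
`x` with `min i j < x ≤ max i j`. The other arc is its complement. -/
def arc {n : ℕ} (i j : Fin n) : Finset (Fin n) := Ioc (min i j) (max i j)

theorem mem_arc {n : ℕ} (i j x : Fin n) : x ∈ arc i j ↔ ¬ (i < x ↔ j < x) := by
  simp only [arc, mem_Ioc, min_lt_iff, ← not_lt, max_lt_iff]
  tauto

/-- The primed vertices `i'` and `j'` are in the same region of the circle representation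
of `π`, i.e. no (convex hull of a) block of `π` separates them: each block lies entirely on one
side of the chord from `i'` to `j'`. -/
def SameRegion {n : ℕ} (π : Finpartition (univ : Finset (Fin n))) (i j : Fin n) : Prop :=
  ∀ B ∈ π.parts, B ⊆ arc i j ∨ Disjoint B (arc i j)

instance {n : ℕ} (π : Finpartition (univ : Finset (Fin n))) : DecidableRel (SameRegion π) :=
  fun i j => by unfold SameRegion; infer_instance

/-- Being in the same region, as an equivalence relation on the primed vertices. -/
def regionSetoid {n : ℕ} (π : Finpartition (univ : Finset (Fin n))) : Setoid (Fin n) where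
  r := SameRegion π
  iseqv :=
    { refl := fun i B _ => Or.inr (by simp [arc])
      symm := fun {i j} h B hB => by simpa [arc, min_comm, max_comm] using h B hB
      trans := fun {i j k} h h' B hB => by
        have h₁ := h B hB
        have h₂ := h' B hB
        simp only [Finset.subset_iff, Finset.disjoint_left, mem_arc] at h₁ h₂ ⊢
        rcases h₁ with h₁ | h₁ <;> rcases h₂ with h₂ | h₂
        · exact Or.inr fun x hx => by have := h₁ hx; have := h₂ hx; tauto
        · exact Or.inl fun x hx => by have := h₁ hx; have := h₂ hx; tauto
        · exact Or.inl fun x hx => by have := h₁ hx; have := h₂ hx; tauto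
        · exact Or.inr fun x hx => by have := h₁ hx; have := h₂ hx; tauto }

instance {n : ℕ} (π : Finpartition (univ : Finset (Fin n))) : DecidableRel (regionSetoid π) :=
  inferInstanceAs (DecidableRel (SameRegion π))

/-- The Kreweras dual `π'`: the partition of the primed vertices `1', …, n'` (where `i'` sits
between `i` and `i + 1`) into regions. The primed vertex `i'` is represented by `i` itself. -/
def dual {n : ℕ} (π : Finpartition (univ : Finset (Fin n))) :
    Finpartition (univ : Finset (Fin n)) :=
  Finpartition.ofSetoid (regionSetoid π)

/-- `NC d n`: the `d`-indivisible noncrossing partitions of `[n]`, i.e. the noncrossing partitions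
`π` such that all blocks of `π` and of `π'` have cardinality congruent to `1` modulo `d`. -/
def NC (d n : ℕ) : Finset (Finpartition (univ : Finset (Fin n))) :=
  {π | IsNoncrossing π ∧ (∀ B ∈ π.parts, #B ≡ 1 [MOD d]) ∧
    (∀ B ∈ (dual π).parts, #B ≡ 1 [MOD d])}

variable {R : Type*} [CommRing R]

/-- The weight of `π`. For `π ∈ NC d (d * k + 1)` all the divisions are exact; the exponents of
`s` and `t` are the corank and the rank of `π`. -/
def wt (d : ℕ) (a a' : ℕ → R) (s t : R) {n : ℕ}
    (π : Finpartition (univ : Finset (Fin n))) : R :=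
  (∏ B ∈ π.parts, a ((#B - 1) / d)) * (∏ B ∈ (dual π).parts, a' ((#B - 1) / d)) *
    s ^ ((#π.parts - 1) / d) * t ^ ((#(dual π).parts - 1) / d)

/-- `b(k)`: the sum of the weights over all of `NC d (d * k + 1)`. -/
def b (d : ℕ) (a a' : ℕ → R) (s t : R) (k : ℕ) : R :=
  ∑ π ∈ NC d (d * k + 1), wt d a a' s t π

/-- `c(k)`: the sum of the weights over the partitions having `{1}` as a block. -/
def c (d : ℕ) (a a' : ℕ → R) (s t : R) (k : ℕ) : R :=
  ∑ π ∈ NC d (d * k + 1) with {0} ∈ π.parts, wt d a a' s t π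

/-- `c*(k)`: the sum of the weights over the partitions having `{1'}` as a block of the dual. -/
def cStar (d : ℕ) (a a' : ℕ → R) (s t : R) (k : ℕ) : R :=
  ∑ π ∈ NC d (d * k + 1) with {0} ∈ (dual π).parts, wt d a a' s t π

end IndivisibleNC

/-! A noncrossing partition is cut at the largest element `i` of the block of `0`: what lies below
`i` and what lies above `i` are independent noncrossing partitions. Iterating this encodes
noncrossing partitions by binary trees (`exists_low_eq`, `eq_of_low_eq`), and the Kreweras dual
becomes the mirror tree read backwards (`colow_eq_iff`). A new root lengthens the block of `0` in
the left part and the dual block of the last element in the right part, each by one.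

Let `leftGF φ` and `rightGF φ` be the generating functions in which one of these two special blocks
is reweighted by `φ`. The root decomposition gives a recursion that replaces `φ` by its shift, and
power series substitution obeys the same recursion; hence `leftGF φ` is `φ` evaluated at `X *
rightGF`, with `rightGF` taken at the shifted dual weights, and symmetrically (`leftGF_eq_subst`,
`rightGF_eq_subst`).

Since `|π| + |π'| = n + 1` on `n` elements, the powers of `s` and `t` distribute over the dual
blocks and the blocks, so `wt` is a product of block weights `sizeWt`, which vanish off sizes `1`
modulo `d`. With these weights `leftGF` and `rightGF` at the shifted weights are `C*(x^d)` and
`C(x^d)`, and the three equations follow by injectivity of `x ↦ x^d`. Uniqueness holds because each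
equation gains a factor `X`. -/

namespace IndivisibleNC

open Finset BinaryTree

/-! ### Encoding of noncrossing partitions by binary trees -/

/-- The mirror image of a binary tree. -/
def mirror : BinaryTree Unit → BinaryTree Unit
  | nil => nil
  | node _ l r => node () (mirror r) (mirror l)

@[simp] theorem numNodes_mirror (t : BinaryTree Unit) : (mirror t).numNodes = t.numNodes := by
  induction t with
  | nil => rfl
  | node _ l r hl hr => simp [mirror, hl, hr, add_comm]

/-- A binary tree with `n` nodes encodes a noncrossing partition of `{0, …, n - 1}`: at a node
whose left subtree has `i` nodes, the subtrees encode partitions of `{0, …, i - 1}` and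
`{i + 1, …, n - 1}`, and `i` is added to the block of `0`. `low t x` is the least element of
the block of `x`. -/
def low : BinaryTree Unit → ℕ → ℕ
  | nil, _ => 0
  | node _ l r, x =>
    if x < l.numNodes then low l x
    else if x = l.numNodes then 0
    else l.numNodes + 1 + low r (x - (l.numNodes + 1))

/-- Labels of the blocks of the Kreweras dual of the partition encoded by `t`. -/
def colow (t : BinaryTree Unit) (x : ℕ) : ℕ := low (mirror t) (t.numNodes - 1 - x)

section node

variable (u : Unit) (l r : BinaryTree Unit)

theorem low_node_left {x : ℕ} (hx : x < l.numNodes) : low (node u l r) x = low l x := by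
  simp [low, hx]

theorem low_node_mid : low (node u l r) l.numNodes = 0 := by simp [low]

theorem low_node_right (x : ℕ) :
    low (node u l r) (l.numNodes + 1 + x) = l.numNodes + 1 + low r x := by
  have h₁ : ¬ l.numNodes + 1 + x < l.numNodes := by omega
  have h₂ : ¬ l.numNodes + 1 + x = l.numNodes := by omega
  simp [low, h₁, h₂]

theorem colow_node_left {x : ℕ} (hx : x < l.numNodes) :
    colow (node u l r) x = r.numNodes + 1 + colow l x := by
  have h : l.numNodes + r.numNodes + 1 - 1 - x
      = (mirror r).numNodes + 1 + (l.numNodes - 1 - x) := by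
    rw [numNodes_mirror]; omega
  simp only [colow, mirror, numNodes]
  rw [h, low_node_right, numNodes_mirror]

theorem colow_node_mid : colow (node u l r) l.numNodes = 0 := by
  have h : l.numNodes + r.numNodes + 1 - 1 - l.numNodes = (mirror r).numNodes := by
    rw [numNodes_mirror]; omega
  simp only [colow, mirror, numNodes]
  rw [h, low_node_mid]

theorem colow_node_right {x : ℕ} (hx : x < r.numNodes) :
    colow (node u l r) (l.numNodes + 1 + x) = colow r x := by
  have h : l.numNodes + r.numNodes + 1 - 1 - (l.numNodes + 1 + x) = r.numNodes - 1 - x := by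
    omega
  simp only [colow, mirror, numNodes]
  rw [h, low_node_left]
  rw [numNodes_mirror]; omega

end node

/-- A position in the partition encoded by a node is in the left part, the new element or in the
right part. -/
theorem position_cases {i j x : ℕ} (hx : x < i + j + 1) :
    x < i ∨ x = i ∨ ∃ y < j, x = i + 1 + y := by
  rcases lt_trichotomy x i with h | h | h
  · exact .inl h
  · exact .inr (.inl h)
  · exact .inr (.inr ⟨x - (i + 1), by omega, by omega⟩)

theorem low_le (t : BinaryTree Unit) : ∀ x < t.numNodes, low t x ≤ x := by
  induction t with
  | nil => simp
  | node u l r hl hr =>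
    intro x hx
    rcases position_cases hx with h | rfl | ⟨y, hy, rfl⟩
    · rw [low_node_left _ _ _ h]; exact hl x h
    · rw [low_node_mid]; omega
    · rw [low_node_right]; have := hr y hy; omega

theorem low_zero (t : BinaryTree Unit) : low t 0 = 0 := by
  cases t with
  | nil => rfl
  | node u l r => exact Nat.le_zero.1 (low_le _ 0 (by simp))

theorem low_low (t : BinaryTree Unit) : ∀ x < t.numNodes, low t (low t x) = low t x := by
  induction t with
  | nil => simp
  | node u l r hl hr =>
    intro x hx
    rcases position_cases hx with h | rfl | ⟨y, hy, rfl⟩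
    · rw [low_node_left _ _ _ h, low_node_left _ _ _ ((low_le l x h).trans_lt h), hl x h]
    · rw [low_node_mid, low_zero]
    · rw [low_node_right, low_node_right, hr y hy]

/-- Labels in the right part exceed the root position, so no block meets both the right part and its
complement. A crossing ending at the root position becomes a crossing in the left part that starts
at `0`, as the two share a block. -/
theorem low_noncrossing (t : BinaryTree Unit) : ∀ x y z w, x < y → y < z → z < w →
    w < t.numNodes → low t x = low t z → low t y = low t w → low t x = low t y := by
  induction t with
  | nil => simp
  | node u l r hl hr =>
    intro x y z w hxy hyz hzw hw
    have hle := low_le l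
    rcases position_cases hw with h | rfl | ⟨w, hw', rfl⟩
    · rw [low_node_left _ _ _ h, low_node_left _ _ _ (hzw.trans h),
        low_node_left _ _ _ (hyz.trans (hzw.trans h)),
        low_node_left _ _ _ (hxy.trans (hyz.trans (hzw.trans h)))]
      exact hl x y z w hxy hyz hzw h
    · rw [low_node_mid, low_node_left _ _ _ hzw, low_node_left _ _ _ (hyz.trans hzw),
        low_node_left _ _ _ (hxy.trans (hyz.trans hzw))]
      intro h₁ h₂
      by_cases h0 : x = 0
      · subst h0; rw [low_zero, h₂]
      · rw [h₂, ← low_zero l]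
        exact (hl 0 x y z (by omega) hxy hyz hzw (by rw [low_zero, h₂]) h₁).symm
    · rw [low_node_right]
      rcases position_cases (show y < l.numNodes + r.numNodes + 1 by simp at hw; omega)
        with h | rfl | ⟨y, hy, rfl⟩
      · intro _ h₂
        rw [low_node_left _ _ _ h] at h₂
        have := hle y h; omega
      · intro _ h₂
        rw [low_node_mid] at h₂; omega
      · obtain ⟨z, rfl⟩ : ∃ z', z = l.numNodes + 1 + z' := ⟨z - (l.numNodes + 1), by omega⟩
        rcases position_cases (show x < l.numNodes + r.numNodes + 1 by simp at hw; omega)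
          with h | rfl | ⟨x, hx, rfl⟩
        · rw [low_node_left _ _ _ h, low_node_right]
          intro h₂; have := hle x h; omega
        · rw [low_node_mid, low_node_right]
          intro h₂; omega
        · simp only [low_node_right, add_right_inj]
          exact hr x y z w (by omega) (by omega) (by omega) (by omega)

/-- Two primed vertices have the same label if and only if no block separates them. -/
theorem colow_eq_iff (t : BinaryTree Unit) : ∀ a b, a ≤ b → b < t.numNodes →
    (colow t a = colow t b ↔ ∀ x < t.numNodes, ∀ y < t.numNodes, low t x = low t y →
      ((a < x ∧ x ≤ b) ↔ (a < y ∧ y ≤ b))) := by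
  induction t with
  | nil => simp
  | node u l r hl hr =>
    intro a b hab hb
    have hle := low_le l
    have hn : (node u l r).numNodes = l.numNodes + r.numNodes + 1 := rfl
    rcases position_cases hb with h | rfl | ⟨b, hb', rfl⟩
    · rw [colow_node_left _ _ _ h, colow_node_left _ _ _ (hab.trans_lt h), add_right_inj,
        hl a b hab h]
      constructor
      · intro H x hx y hy hxy
        rcases position_cases hx with hx | rfl | ⟨x, hx, rfl⟩ <;>
        rcases position_cases hy with hy | rfl | ⟨y, hy, rfl⟩
        · rw [low_node_left _ _ _ hx, low_node_left _ _ _ hy] at hxy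
          exact H x hx y hy hxy
        · rw [low_node_left _ _ _ hx, low_node_mid] at hxy
          -- The root position lies outside the arc, as `0` does, so `0` stands in for it.
          have := H x hx 0 (by omega) (by rw [low_zero, hxy])
          omega
        · rw [low_node_left _ _ _ hx, low_node_right] at hxy
          have := hle x hx; omega
        · rw [low_node_left _ _ _ hy, low_node_mid] at hxy
          have := H 0 (by omega) y hy (by rw [low_zero, hxy])
          omega
        · rfl
        · omega
        · rw [low_node_left _ _ _ hy, low_node_right] at hxy
          have := hle y hy; omega
        · omega
        · omega
      · intro H x hx y hy hxy
        exact H x (by omega) y (by omega)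
          (by rwa [low_node_left _ _ _ hx, low_node_left _ _ _ hy])
    · rcases hab.lt_or_eq with h | rfl
      · rw [colow_node_mid, colow_node_left _ _ _ h]
        refine iff_of_false (by omega) fun H => ?_
        -- `0` and the root position share a block and lie on different sides of the chord.
        have := H 0 (by omega) l.numNodes (by omega) (by rw [low_zero, low_node_mid])
        omega
      · exact iff_of_true rfl fun x _ y _ _ => by omega
    · rw [colow_node_right _ _ _ hb']
      rcases position_cases (hab.trans_lt hb) with h | rfl | ⟨a, ha', rfl⟩
      · rw [colow_node_left _ _ _ h]
        refine iff_of_false ?_ fun H => ?_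
        · have : colow r b ≤ r.numNodes - 1 - b := by
            have := low_le (mirror r) (r.numNodes - 1 - b) (by rw [numNodes_mirror]; omega)
            exact this
          omega
        · have := H 0 (by omega) l.numNodes (by omega) (by rw [low_zero, low_node_mid])
          omega
      · rw [colow_node_mid]
        -- The root's primed vertex joins the dual block of the last primed vertex, whose label is
        -- `0`. On the right part the arcs from the root to `b` and from `b` to the end are
        -- complementary.
        have h0 : colow r (r.numNodes - 1) = 0 := by simp [colow, low_zero]
        rw [← h0, eq_comm, hr b (r.numNodes - 1) (by omega) (by omega)]
        constructor
        · intro H x hx y hy hxy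
          rcases position_cases hx with hx | rfl | ⟨x, hx, rfl⟩ <;>
          rcases position_cases hy with hy | rfl | ⟨y, hy, rfl⟩
          · omega
          · omega
          · rw [low_node_left _ _ _ hx, low_node_right] at hxy
            have := hle x hx; omega
          · omega
          · omega
          · rw [low_node_mid, low_node_right] at hxy; omega
          · rw [low_node_left _ _ _ hy, low_node_right] at hxy
            have := hle y hy; omega
          · rw [low_node_mid, low_node_right] at hxy; omega
          · rw [low_node_right, low_node_right, add_right_inj] at hxy
            have := H x (by omega) y (by omega) hxy; omega
        · intro H x hx y hy hxy
          have := H (l.numNodes + 1 + x) (by omega) (l.numNodes + 1 + y) (by omega)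
            (by rw [low_node_right, low_node_right, hxy])
          omega
      · rw [colow_node_right _ _ _ ha', hr a b (by omega) hb']
        constructor
        · intro H x hx y hy hxy
          rcases position_cases hx with hx | rfl | ⟨x, hx, rfl⟩ <;>
          rcases position_cases hy with hy | rfl | ⟨y, hy, rfl⟩
          · omega
          · omega
          · rw [low_node_left _ _ _ hx, low_node_right] at hxy
            have := hle x hx; omega
          · omega
          · omega
          · rw [low_node_mid, low_node_right] at hxy; omega
          · rw [low_node_left _ _ _ hy, low_node_right] at hxy
            have := hle y hy; omega
          · rw [low_node_mid, low_node_right] at hxy; omega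
          · rw [low_node_right, low_node_right, add_right_inj] at hxy
            have := H x (by omega) y (by omega) hxy; omega
        · intro H x hx y hy hxy
          have := H (l.numNodes + 1 + x) (by omega) (l.numNodes + 1 + y) (by omega)
            (by rw [low_node_right, low_node_right, hxy])
          omega

/-- The size of the left subtree is the last position with label `0`, so the labels determine the
root decomposition. -/
theorem eq_of_low_eq (t : BinaryTree Unit) : ∀ t' : BinaryTree Unit, t.numNodes = t'.numNodes →
    (∀ x < t.numNodes, low t x = low t' x) → t = t' := by
  induction t with
  | nil =>
    intro t' h _
    cases t' with
    | nil => rfl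
    | node => simp at h
  | node u l r hl hr =>
    intro t' h H
    cases t' with
    | nil => simp at h
    | node u' l' r' =>
      simp only [numNodes] at h H
      have hi : l.numNodes = l'.numNodes := by
        rcases lt_trichotomy l.numNodes l'.numNodes with hlt | heq | hlt
        · have := H l'.numNodes (by omega)
          obtain ⟨y, hy⟩ : ∃ y, l'.numNodes = l.numNodes + 1 + y :=
            ⟨l'.numNodes - (l.numNodes + 1), by omega⟩
          rw [low_node_mid, hy, low_node_right] at this
          omega
        · exact heq
        · have := H l.numNodes (by omega)
          obtain ⟨y, hy⟩ : ∃ y, l.numNodes = l'.numNodes + 1 + y :=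
            ⟨l.numNodes - (l'.numNodes + 1), by omega⟩
          rw [low_node_mid, hy, low_node_right] at this
          omega
      congr 1
      · refine hl l' hi fun x hx => ?_
        have := H x (by omega)
        rwa [low_node_left _ _ _ hx, low_node_left _ _ _ (hi ▸ hx)] at this
      · refine hr r' (by omega) fun x hx => ?_
        have := H (l.numNodes + 1 + x) (by omega)
        rw [low_node_right, hi, low_node_right] at this
        omega

/-- Every noncrossing partition, given by the function sending an element to the least element of
its block, is encoded by a tree. -/
theorem exists_low_eq (n : ℕ) : ∀ f : ℕ → ℕ, (∀ x < n, f x ≤ x) → (∀ x < n, f (f x) = f x) →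
    (∀ x y z w, x < y → y < z → z < w → w < n → f x = f z → f y = f w → f x = f y) →
    ∃ t : BinaryTree Unit, t.numNodes = n ∧ ∀ x < n, low t x = f x := by
  induction n using Nat.strong_induction_on with
  | _ n ih =>
    intro f hle hidem hnc
    rcases Nat.eq_zero_or_pos n with rfl | hn
    · exact ⟨nil, rfl, by simp⟩
    have h00 : f 0 = 0 := Nat.le_zero.1 (hle 0 hn)
    obtain ⟨i, hin, hi0, hmax⟩ : ∃ i < n, f i = 0 ∧ ∀ x < n, i < x → f x ≠ 0 := by
      have hne : ((range n).filter (fun x => f x = 0)).Nonempty := ⟨0, by simp [hn, h00]⟩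
      have hm := max'_mem _ hne
      rw [mem_filter, mem_range] at hm
      refine ⟨_, hm.1, hm.2, fun x hx hlt h0 => ?_⟩
      have := le_max' _ x (by simp [hx, h0] : x ∈ (range n).filter (fun x => f x = 0))
      omega
    -- Otherwise `0 < f x < i < x` would be a crossing of two blocks.
    have hge : ∀ x < n, i < x → i < f x := by
      intro x hx hix
      by_contra hcon
      have hidx := hidem x hx
      have h0 := hmax x hx hix
      rcases lt_or_eq_of_le (not_lt.1 hcon) with h | h
      · have := hnc 0 (f x) i x (by omega) h hix hx (by rw [h00, hi0]) hidx
        rw [h00, hidx] at this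
        omega
      · rw [h, hi0] at hidx; omega
    obtain ⟨l, hl, hl'⟩ := ih i hin f (fun x hx => hle x (by omega))
      (fun x hx => hidem x (by omega))
      (fun x y z w h₁ h₂ h₃ h₄ => hnc x y z w h₁ h₂ h₃ (by omega))
    obtain ⟨r, hr, hr'⟩ := ih (n - (i + 1)) (by omega) (fun x => f (i + 1 + x) - (i + 1))
      (fun x hx => by have := hle (i + 1 + x) (by omega); omega)
      (fun x hx => by
        have h₁ := hge (i + 1 + x) (by omega) (by omega)
        have h₂ := hidem (i + 1 + x) (by omega)
        rw [show i + 1 + (f (i + 1 + x) - (i + 1)) = f (i + 1 + x) by omega, h₂])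
      (fun x y z w h₁ h₂ h₃ h₄ h₅ h₆ => by
        have e₁ := hge (i + 1 + x) (by omega) (by omega)
        have e₂ := hge (i + 1 + y) (by omega) (by omega)
        have e₃ := hge (i + 1 + z) (by omega) (by omega)
        have e₄ := hge (i + 1 + w) (by omega) (by omega)
        have := hnc (i + 1 + x) (i + 1 + y) (i + 1 + z) (i + 1 + w) (by omega) (by omega)
          (by omega) (by omega) (by omega) (by omega)
        omega)
    refine ⟨node () l r, by simp only [numNodes]; omega, fun x hx => ?_⟩
    rcases position_cases (show x < l.numNodes + r.numNodes + 1 by omega)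
      with h | rfl | ⟨y, hy, rfl⟩
    · rw [low_node_left _ _ _ h, hl' x (by omega)]
    · rw [low_node_mid, hl, hi0]
    · rw [low_node_right, hr' y (by omega), hl]
      have := hge (i + 1 + y) (by omega) (by omega)
      omega

/-! ### Block sizes and block weights of a tree -/

/-- The number of nodes on the left spine: the size of the block of `0`. -/
def spine : BinaryTree Unit → ℕ
  | nil => 0
  | node _ l _ => spine l + 1

section weights

variable {M : Type*} [CommMonoid M] (α : ℕ → M)

/-- The product of the weights of the blocks not containing `0`. -/
def openWt : BinaryTree Unit → M
  | nil => 1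
  | node _ l r => openWt l * (α (spine r) * openWt r)

/-- The product of the weights of all the blocks. -/
def blockWt (t : BinaryTree Unit) : M := α (spine t) * openWt α t

/-- The number of elements of the block with least element `v`. -/
def blockSize (t : BinaryTree Unit) (v : ℕ) : ℕ := #{x ∈ range t.numNodes | low t x = v}

theorem blockSize_node (u : Unit) (l r : BinaryTree Unit) (v : ℕ) :
    blockSize (node u l r) v = blockSize l v + (if v = 0 then 1 else 0) +
      (if l.numNodes < v then blockSize r (v - (l.numNodes + 1)) else 0) := by
  simp only [blockSize, card_filter, numNodes]
  rw [show l.numNodes + r.numNodes + 1 = l.numNodes + 1 + r.numNodes by omega,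
    sum_range_add, sum_range_succ, low_node_mid]
  congr 1
  · congr 1
    · exact sum_congr rfl fun x hx => by rw [low_node_left _ _ _ (mem_range.1 hx)]
    · simp [eq_comm]
  · split_ifs with h
    · refine sum_congr rfl fun x _ => ?_
      rw [low_node_right]
      exact if_congr (by omega) rfl rfl
    · refine sum_eq_zero fun x _ => ?_
      rw [low_node_right, if_neg (by omega)]

theorem blockSize_of_le (t : BinaryTree Unit) {v : ℕ} (hv : t.numNodes ≤ v) :
    blockSize t v = 0 := by
  rw [blockSize, card_eq_zero, filter_eq_empty_iff]
  intro x hx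
  have := low_le t x (mem_range.1 hx)
  have := mem_range.1 hx
  omega

theorem blockSize_zero (t : BinaryTree Unit) : blockSize t 0 = spine t := by
  induction t with
  | nil => rfl
  | node u l r hl _ => simp [blockSize_node, hl, spine]

/-- Labels `1, …, l.numNodes` get their blocks from `l`; the remaining ones are the labels `0, …,
r.numNodes` of `r`. The top label is always empty and contributes `α 0` on both sides. -/
theorem prod_blockSize_succ (t : BinaryTree Unit) :
    ∏ v ∈ range t.numNodes, α (blockSize t (v + 1)) = openWt α t := by
  induction t with
  | nil => simp [openWt]
  | node u l r hl hr =>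
    simp only [numNodes, openWt]
    rw [add_assoc, prod_range_add, ← hl, ← hr]
    congr 1
    · refine prod_congr rfl fun v hv => ?_
      have := mem_range.1 hv
      rw [blockSize_node, if_neg (by omega), if_neg (by omega)]
      rfl
    · rw [← blockSize_zero, mul_comm, ← prod_range_succ' (fun v => α (blockSize r v))]
      refine prod_congr rfl fun v hv => ?_
      rw [blockSize_node, blockSize_of_le l (by omega), if_neg (by omega), if_pos (by omega)]
      congr 2
      simp

theorem prod_blockSize (t : BinaryTree Unit) (h0 : α 0 = 1) :
    ∏ v ∈ range t.numNodes, α (blockSize t v) = blockWt α t := by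
  rw [blockWt, ← prod_blockSize_succ α t, ← blockSize_zero, mul_comm,
    ← prod_range_succ' (fun v => α (blockSize t v)), prod_range_succ,
    blockSize_of_le t le_rfl, h0, mul_one]

end weights

/-! ### Partitions into fibers of a label function -/

section fibers

variable {n : ℕ}

instance decidableRel_ker (f : Fin n → ℕ) : DecidableRel (Setoid.ker f) :=
  fun x y => inferInstanceAs (Decidable (f x = f y))

/-- The partition of `Fin n` into the nonempty fibers of `f`. -/
def fiberPartition (f : Fin n → ℕ) : Finpartition (univ : Finset (Fin n)) :=
  Finpartition.ofSetoid (Setoid.ker f)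

theorem mem_part_fiberPartition (f : Fin n → ℕ) (x y : Fin n) :
    y ∈ (fiberPartition f).part x ↔ f x = f y :=
  Finpartition.mem_part_ofSetoid_iff_rel

theorem mem_parts_fiberPartition (f : Fin n → ℕ) (B : Finset (Fin n)) :
    B ∈ (fiberPartition f).parts ↔ ∃ x, B = univ.filter (fun y => f x = f y) := by
  constructor
  · intro hB
    obtain ⟨x, hx⟩ := (fiberPartition f).nonempty_of_mem_parts hB
    refine ⟨x, ?_⟩
    ext y
    rw [← (fiberPartition f).part_eq_of_mem hB hx, mem_part_fiberPartition]
    simp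
  · rintro ⟨x, rfl⟩
    convert (fiberPartition f).part_mem.2 (mem_univ x) using 1
    ext y
    rw [mem_part_fiberPartition]
    simp

/-- Because `α 0 = 1`, unused labels may be included, and a product over a full range of labels can
be split along the tree. -/
theorem prod_parts_fiberPartition {M : Type*} [CommMonoid M] (α : ℕ → M) (h0 : α 0 = 1)
    (f : Fin n → ℕ) (N : ℕ) (hf : ∀ x, f x < N) :
    ∏ B ∈ (fiberPartition f).parts, α #B = ∏ v ∈ range N, α #{x | f x = v} := by
  have hparts : (fiberPartition f).parts
      = (univ.image f).image (fun v => ({x | f x = v} : Finset (Fin n))) := by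
    ext B
    simp [mem_parts_fiberPartition, eq_comm]
  rw [hparts, prod_image]
  · refine prod_subset (fun v hv => ?_) fun v _ hv => ?_
    · obtain ⟨x, -, rfl⟩ := mem_image.1 hv
      exact mem_range.2 (hf x)
    · rw [show ({x | f x = v} : Finset (Fin n)) = ∅ from
        filter_eq_empty_iff.2 fun x _ hx => hv (mem_image.2 ⟨x, mem_univ x, hx⟩)]
      simpa using h0
  · intro v hv w _ hvw
    obtain ⟨x, -, rfl⟩ := mem_image.1 hv
    have : x ∈ ({y | f y = w} : Finset (Fin n)) := by
      rw [← show _ = ({y | f y = w} : Finset (Fin n)) from hvw]; simp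
    simpa using this

theorem eq_fiberPartition (π : Finpartition (univ : Finset (Fin n))) (f : Fin n → ℕ)
    (h : ∀ x y, π.part x = π.part y ↔ f x = f y) : π = fiberPartition f := by
  ext B
  rw [mem_parts_fiberPartition]
  have hpart : ∀ x, π.part x = univ.filter (fun y => f x = f y) := by
    intro x
    ext y
    rw [π.mem_part_iff_part_eq_part (mem_univ _) (mem_univ _), eq_comm, h]
    simp
  constructor
  · intro hB
    obtain ⟨x, hx⟩ := π.nonempty_of_mem_parts hB
    exact ⟨x, by rw [← hpart, π.part_eq_of_mem hB hx]⟩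
  · rintro ⟨x, rfl⟩
    rw [← hpart]
    exact π.part_mem.2 (mem_univ x)

theorem sameRegion_fiberPartition (f : Fin n → ℕ) (i j : Fin n) :
    SameRegion (fiberPartition f) i j ↔
      ∀ x y, f x = f y → (x ∈ arc i j ↔ y ∈ arc i j) := by
  constructor
  · intro H x y hxy
    have hx : x ∈ ({y | f x = f y} : Finset (Fin n)) := by simp
    have hy : y ∈ ({y | f x = f y} : Finset (Fin n)) := by simp [hxy]
    rcases H _ ((mem_parts_fiberPartition f _).2 ⟨x, rfl⟩) with h | h
    · exact iff_of_true (h hx) (h hy)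
    · exact iff_of_false (disjoint_left.1 h hx) (disjoint_left.1 h hy)
  · intro H B hB
    obtain ⟨x, rfl⟩ := (mem_parts_fiberPartition f B).1 hB
    by_cases hx : x ∈ arc i j
    · exact .inl fun y hy => (H x y (by simpa using hy)).1 hx
    · exact .inr (disjoint_left.2 fun y hy hy' => hx ((H x y (by simpa using hy)).2 hy'))

theorem isNoncrossing_fiberPartition (f : Fin n → ℕ) :
    IsNoncrossing (fiberPartition f) ↔
      ∀ x y z w, x < y → y < z → z < w → f x = f z → f y = f w → f x = f y := by
  constructor
  · intro H x y z w h₁ h₂ h₃ hxz hyw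
    by_contra hxy
    refine H _ ((mem_parts_fiberPartition f _).2 ⟨x, rfl⟩) _
      ((mem_parts_fiberPartition f _).2 ⟨y, rfl⟩) (fun h => hxy ?_)
      ⟨x, by simp, y, by simp, z, by simp [hxz], w, by simp [hyw], h₁, h₂, h₃⟩
    have : y ∈ ({z | f x = f z} : Finset (Fin n)) := by rw [h]; simp
    simpa using this
  · rintro H B hB B' hB' hne ⟨x, hx, y, hy, z, hz, w, hw, h₁, h₂, h₃⟩
    obtain ⟨p, rfl⟩ := (mem_parts_fiberPartition f B).1 hB
    obtain ⟨q, rfl⟩ := (mem_parts_fiberPartition f B').1 hB'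
    simp only [mem_filter, mem_univ, true_and] at hx hy hz hw
    refine hne ?_
    rw [hx, hy, H x y z w h₁ h₂ h₃ (hx ▸ hz) (hy ▸ hw)]

end fibers

/-! ### The bijection between trees and noncrossing partitions -/

/-- The partition of `Fin n` encoded by a tree with `n` nodes. -/
def treePartition (n : ℕ) (t : BinaryTree Unit) : Finpartition (univ : Finset (Fin n)) :=
  fiberPartition fun x => low t x

section treePartition

variable {n : ℕ} {t : BinaryTree Unit}

theorem dual_treePartition (ht : t.numNodes = n) :
    dual (treePartition n t) = fiberPartition fun x : Fin n => colow t x := by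
  refine eq_fiberPartition _ _ fun i j => ?_
  rw [← Finpartition.mem_part_iff_part_eq_part _ (mem_univ _) (mem_univ _)]
  have key : ∀ i j : Fin n, i ≤ j →
      (SameRegion (treePartition n t) i j ↔ colow t i = colow t j) := by
    intro i j hij
    rw [colow_eq_iff t i j hij (ht ▸ j.2), treePartition, sameRegion_fiberPartition]
    simp only [arc, min_eq_left hij, max_eq_right hij, mem_Ioc]
    exact ⟨fun H x hx y hy => H ⟨x, ht ▸ hx⟩ ⟨y, ht ▸ hy⟩,
      fun H x y => H x (ht ▸ x.2) y (ht ▸ y.2)⟩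
  have hrel : i ∈ (dual (treePartition n t)).part j ↔ SameRegion (treePartition n t) j i :=
    Finpartition.mem_part_ofSetoid_iff_rel
  rw [hrel]
  rcases le_total i j with h | h
  · rw [← key i j h]
    exact ⟨(regionSetoid _).symm, (regionSetoid _).symm⟩
  · rw [key j i h, eq_comm]

theorem isNoncrossing_treePartition (ht : t.numNodes = n) :
    IsNoncrossing (treePartition n t) := by
  rw [treePartition, isNoncrossing_fiberPartition]
  exact fun x y z w h₁ h₂ h₃ => low_noncrossing t x y z w h₁ h₂ h₃ (ht ▸ w.2)

theorem card_fiber_low (ht : t.numNodes = n) (v : ℕ) :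
    #{x : Fin n | low t x = v} = blockSize t v := by
  rw [blockSize, ht, card_filter, card_filter, sum_range]

theorem card_fiber_colow (ht : t.numNodes = n) (v : ℕ) :
    #{x : Fin n | colow t x = v} = blockSize (mirror t) v := by
  rw [← card_fiber_low (n := n) (by rw [numNodes_mirror, ht])]
  refine card_equiv Fin.revPerm fun x => ?_
  simp only [mem_filter, mem_univ, true_and, colow, Fin.revPerm_apply, Fin.val_rev, ht]
  rw [show n - (↑x + 1) = n - 1 - x by omega]

theorem prod_parts_treePartition (ht : t.numNodes = n) {M : Type*} [CommMonoid M] (α : ℕ → M)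
    (h0 : α 0 = 1) : ∏ B ∈ (treePartition n t).parts, α #B = blockWt α t := by
  rw [treePartition, prod_parts_fiberPartition α h0 _ n
    fun x => (low_le t x (ht ▸ x.2)).trans_lt x.2, ← prod_blockSize α t h0, ht]
  exact prod_congr rfl fun v _ => by rw [card_fiber_low ht]

theorem prod_parts_dual_treePartition (ht : t.numNodes = n) {M : Type*} [CommMonoid M] (α : ℕ → M)
    (h0 : α 0 = 1) : ∏ B ∈ (dual (treePartition n t)).parts, α #B = blockWt α (mirror t) := by
  rw [dual_treePartition ht, prod_parts_fiberPartition α h0 _ n, ← prod_blockSize α _ h0,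
    numNodes_mirror, ht]
  · exact prod_congr rfl fun v _ => by rw [card_fiber_colow ht]
  · intro x
    have := x.2
    have := low_le (mirror t) (t.numNodes - 1 - x) (by rw [numNodes_mirror]; omega)
    rw [colow]
    omega

end treePartition

theorem treePartition_injOn (n : ℕ) :
    Set.InjOn (treePartition n) (treesOfNumNodesEq n : Set (BinaryTree Unit)) := by
  intro t ht t' ht' h
  rw [mem_coe, mem_treesOfNumNodesEq] at ht ht'
  have hrel : ∀ x < n, ∀ y < n, low t x = low t y ↔ low t' x = low t' y := by
    intro x hx y hy
    have h₁ := mem_part_fiberPartition (fun x : Fin n => low t x) ⟨x, hx⟩ ⟨y, hy⟩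
    have h₂ := mem_part_fiberPartition (fun x : Fin n => low t' x) ⟨x, hx⟩ ⟨y, hy⟩
    rw [treePartition, treePartition] at h
    rw [h, h₂] at h₁
    exact h₁.symm
  refine eq_of_low_eq t t' (by rw [ht, ht']) fun x hx => ?_
  rw [ht] at hx
  have hl := low_le t x (by omega)
  have hl' := low_le t' x (by omega)
  -- Each label lies in the block of `x`, hence bounds the other label from above.
  have e := (hrel x hx (low t x) (by omega)).1 (low_low t x (by omega)).symm
  have e' := (hrel x hx (low t' x) (by omega)).2 (low_low t' x (by omega)).symm
  have := low_le t (low t' x) (by omega)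
  have := low_le t' (low t x) (by omega)
  omega

theorem exists_treePartition_eq {n : ℕ} (π : Finpartition (univ : Finset (Fin n)))
    (hπ : IsNoncrossing π) : ∃ t : BinaryTree Unit, t.numNodes = n ∧ treePartition n t = π := by
  have hne : ∀ x, (π.part x).Nonempty := fun x => ⟨x, π.mem_part (mem_univ x)⟩
  set m : Fin n → Fin n := fun x => (π.part x).min' (hne x) with hm
  have hmem : ∀ x, m x ∈ π.part x := fun x => min'_mem _ _
  have hpart : ∀ x, π.part (m x) = π.part x := fun x =>
    (π.mem_part_iff_part_eq_part (mem_univ _) (mem_univ _)).1 (hmem x)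
  have hiff : ∀ x y, π.part x = π.part y ↔ m x = m y := by
    intro x y
    refine ⟨fun h => ?_, fun h => by rw [← hpart, h, hpart]⟩
    simp only [hm, h]
  have hπ' : π = fiberPartition fun x => (m x : ℕ) :=
    eq_fiberPartition π _ fun x y => by rw [hiff, Fin.ext_iff]
  rw [hπ', isNoncrossing_fiberPartition] at hπ
  set f : ℕ → ℕ := fun x => if h : x < n then m ⟨x, h⟩ else 0 with hf
  have hfm : ∀ x (h : x < n), f x = m ⟨x, h⟩ := fun x h => by simp [hf, h]
  obtain ⟨t, ht, htf⟩ := exists_low_eq n f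
    (fun x hx => by
      rw [hfm x hx]
      exact Fin.le_def.1 (min'_le _ _ (π.mem_part (mem_univ _))))
    (fun x hx => by
      rw [hfm x hx, hfm _ (m ⟨x, hx⟩).2, ← Fin.ext_iff]
      exact (hiff _ _).1 (hpart _))
    (fun x y z w h₁ h₂ h₃ h₄ => by
      rw [hfm x (by omega), hfm y (by omega), hfm z (by omega), hfm w h₄]
      exact hπ _ _ _ _ h₁ h₂ h₃)
  refine ⟨t, ht, ?_⟩
  rw [hπ', treePartition]
  congr 1
  funext x
  rw [htf x x.2, hfm x x.2]

/-- Sums over noncrossing partitions are sums over binary trees. -/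
theorem sum_isNoncrossing {M : Type*} [AddCommMonoid M] (n : ℕ)
    (F : Finpartition (univ : Finset (Fin n)) → M) :
    ∑ π with IsNoncrossing π, F π = ∑ t ∈ treesOfNumNodesEq n, F (treePartition n t) := by
  symm
  refine sum_nbij (treePartition n) (fun t ht => ?_) (treePartition_injOn n) (fun π hπ => ?_)
    fun _ _ => rfl
  · rw [mem_filter]
    exact ⟨mem_univ _, isNoncrossing_treePartition (mem_treesOfNumNodesEq.1 ht)⟩
  · obtain ⟨t, ht, rfl⟩ := exists_treePartition_eq π (by simpa using hπ)
    exact ⟨t, by simpa using ht, rfl⟩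

/-! ### Singleton blocks and the number of blocks -/

/-- The element `0` is alone in its block. -/
def FirstSingleton (t : BinaryTree Unit) : Prop := spine t = 1

/-- The primed element `0'` is alone in its dual block. -/
def FirstCosingleton : BinaryTree Unit → Prop
  | nil => False
  | node _ l r => (l = nil ∧ r = nil) ∨ FirstCosingleton l

theorem singleton_zero_mem_fiberPartition {n : ℕ} (f : Fin (n + 1) → ℕ) :
    {0} ∈ (fiberPartition f).parts ↔ #{x | f x = f 0} = 1 := by
  rw [mem_parts_fiberPartition, card_eq_one]
  constructor
  · rintro ⟨x, hx⟩
    have h0 : (0 : Fin (n + 1)) ∈ ({y | f x = f y} : Finset _) := by rw [← hx]; simp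
    have h0 : f x = f 0 := by simpa using h0
    exact ⟨0, by rw [hx, h0]; ext; simp [eq_comm]⟩
  · rintro ⟨x, hx⟩
    have h0 : (0 : Fin (n + 1)) ∈ ({y | f y = f 0} : Finset _) := by simp
    rw [hx, mem_singleton] at h0
    subst h0
    exact ⟨0, by rw [← hx]; ext; simp [eq_comm]⟩

theorem singleton_zero_mem_treePartition {n : ℕ} {t : BinaryTree Unit} (ht : t.numNodes = n + 1) :
    {0} ∈ (treePartition (n + 1) t).parts ↔ FirstSingleton t := by
  rw [treePartition, singleton_zero_mem_fiberPartition, card_fiber_low ht, Fin.val_zero,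
    low_zero, blockSize_zero, FirstSingleton]

theorem spine_eq_zero {t : BinaryTree Unit} : spine t = 0 ↔ t = nil := by
  cases t <;> simp [spine]

theorem mirror_eq_nil {t : BinaryTree Unit} : mirror t = nil ↔ t = nil := by
  cases t <;> simp [mirror]

/-- Descending into a nonempty left subtree only shifts the label of `0'`. When the left subtree is
empty, the dual block of `0'` has `spine (mirror r) + 1` elements. -/
theorem blockSize_colow_zero_eq_one (t : BinaryTree Unit) (ht : t ≠ nil) :
    blockSize (mirror t) (colow t 0) = 1 ↔ FirstCosingleton t := by
  induction t with
  | nil => exact absurd rfl ht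
  | node u l r hl _ =>
    rw [mirror, FirstCosingleton]
    by_cases h : l = nil
    · subst h
      have : colow (node u nil r) 0 = 0 := colow_node_mid u nil r
      rw [this, blockSize_zero, spine]
      simp [FirstCosingleton, spine_eq_zero, mirror_eq_nil]
    · have hpos : 0 < l.numNodes := by
        cases l with
        | nil => exact absurd rfl h
        | node => simp
      rw [colow_node_left _ _ _ hpos, blockSize_node, blockSize_of_le _ (by simp; omega),
        if_neg (by omega), if_pos (by simp; omega), numNodes_mirror, Nat.add_sub_cancel_left,
        zero_add, zero_add, hl h]
      simp [h]

theorem singleton_zero_mem_dual_treePartition {n : ℕ} {t : BinaryTree Unit}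
    (ht : t.numNodes = n + 1) :
    {0} ∈ (dual (treePartition (n + 1) t)).parts ↔ FirstCosingleton t := by
  rw [dual_treePartition ht, singleton_zero_mem_fiberPartition, card_fiber_colow ht,
    Fin.val_zero, blockSize_colow_zero_eq_one]
  rintro rfl
  simp at ht

/-- The numbers of blocks of a noncrossing partition of `Fin (n + 1)` and of its dual sum up to
`n + 2`. -/
theorem card_parts_add_card_parts_dual {n : ℕ} {t : BinaryTree Unit}
    (ht : t.numNodes = n + 1) :
    #(treePartition (n + 1) t).parts + #(dual (treePartition (n + 1) t)).parts = n + 2 := by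
  -- The indicator of nonempty blocks, written multiplicatively so that the product formulas count
  -- blocks.
  set α : ℕ → Multiplicative ℕ := fun m => Multiplicative.ofAdd (if m = 0 then 0 else 1) with hα
  have h0 : α 0 = 1 := rfl
  have hcard : ∀ π : Finpartition (univ : Finset (Fin (n + 1))),
      Multiplicative.ofAdd #π.parts = ∏ B ∈ π.parts, α #B := by
    intro π
    rw [card_eq_sum_ones, ofAdd_sum]
    refine prod_congr rfl fun B hB => ?_
    rw [hα]
    simp only
    rw [if_neg (card_pos.2 (π.nonempty_of_mem_parts hB)).ne']
  have key : ∀ t : BinaryTree Unit, (openWt α t).toAdd + (openWt α (mirror t)).toAdd + 1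
      = t.numNodes + (if t = nil then 1 else 0) := by
    have hspine : ∀ t, (α (spine t)).toAdd = if t = nil then 0 else 1 := by
      intro t
      simp [hα, spine_eq_zero]
    intro t
    induction t with
    | nil => simp [openWt, mirror]
    | node u l r hl hr =>
      simp only [openWt, mirror, toAdd_mul, hspine, mirror_eq_nil, numNodes]
      simp only [reduceCtorEq, if_false]
      split_ifs at * <;> omega
  have hne : t ≠ nil := by rintro rfl; simp at ht
  have h₁ := (hcard _).trans (prod_parts_treePartition ht α h0)
  have h₂ := (hcard _).trans (prod_parts_dual_treePartition ht α h0)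
  have hs : ∀ t, t ≠ nil → (α (spine t)).toAdd = 1 := fun t h => by
    simp [hα, spine_eq_zero, h]
  apply_fun Multiplicative.toAdd at h₁ h₂
  simp only [toAdd_ofAdd, blockWt, toAdd_mul] at h₁ h₂
  rw [hs t hne] at h₁
  rw [hs _ (mt mirror_eq_nil.1 hne)] at h₂
  have := key t
  rw [if_neg hne] at this
  omega

/-! ### Power series: substitution and uniqueness -/

section powerSeries

open PowerSeries

variable {R : Type*} [CommRing R]

theorem powerSeries_eq_of_X_pow_dvd {f g : R⟦X⟧} (h : ∀ n, X ^ n ∣ f - g) : f = g := by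
  ext n
  have := X_pow_dvd_iff.1 (h (n + 1)) n (Nat.lt_succ_self n)
  rwa [map_sub, sub_eq_zero] at this

theorem hasSubst_X_mul (h : R⟦X⟧) : HasSubst (X * h) :=
  HasSubst.of_constantCoeff_zero' (by simp)

theorem subst_X_mul_mk (φ : ℕ → R) (h : R⟦X⟧) :
    (mk φ).subst (X * h) = C (φ 0) + X * (mk fun k => φ (k + 1)).subst (X * h) * h := by
  have hφ : mk φ = C (φ 0) + X * PowerSeries.mk fun k => φ (k + 1) := by
    ext n
    cases n <;> simp [coeff_succ_X_mul]
  rw [hφ, subst_add (hasSubst_X_mul h), subst_mul (hasSubst_X_mul h),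
    subst_X (hasSubst_X_mul h)]
  have hC : (C (φ 0) : R⟦X⟧).subst (X * h) = C (φ 0) := subst_C _
  rw [hC, mul_right_comm]

/-- Each use of the recursion gains a factor `X`, so the two sides agree modulo every `X ^ n`; the
induction runs over all `φ` at once because `φ` is shifted. -/
theorem eq_of_shift_recursion {D D' : (ℕ → R) → R⟦X⟧} (e : (ℕ → R) → R⟦X⟧) (h : R⟦X⟧)
    (hD : ∀ φ, D φ = e φ + X * D (fun k => φ (k + 1)) * h)
    (hD' : ∀ φ, D' φ = e φ + X * D' (fun k => φ (k + 1)) * h) (φ : ℕ → R) : D φ = D' φ := by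
  refine powerSeries_eq_of_X_pow_dvd fun n => ?_
  induction n generalizing φ with
  | zero => simp
  | succ n ih =>
    obtain ⟨q, hq⟩ := ih fun k => φ (k + 1)
    refine ⟨q * h, ?_⟩
    rw [hD φ, hD' φ, pow_succ]
    linear_combination X * h * hq

theorem X_pow_dvd_subst_sub_subst (f : R⟦X⟧) {u v : R⟦X⟧} (hu : HasSubst u) (hv : HasSubst v)
    {n : ℕ} (h : X ^ n ∣ u - v) : X ^ n ∣ f.subst u - f.subst v := by
  rw [X_pow_dvd_iff]
  intro m hm
  rw [map_sub, coeff_subst' hu, coeff_subst' hv, sub_eq_zero]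
  refine finsum_congr fun k => ?_
  have := X_pow_dvd_iff.1 (h.trans (sub_dvd_pow_sub_pow u v k)) m hm
  rw [map_sub, sub_eq_zero] at this
  rw [this]

/-- A system of two equations of this form has at most one solution. -/
theorem eq_of_subst_system {P Q F G F' G' : R⟦X⟧} (s t : R) (d : ℕ)
    (hF : F = P.subst (X * C s * G ^ d)) (hG : G = Q.subst (X * C t * F ^ d))
    (hF' : F' = P.subst (X * C s * G' ^ d)) (hG' : G' = Q.subst (X * C t * F' ^ d)) :
    F = F' ∧ G = G' := by
  have step : ∀ (P U V : R⟦X⟧) (s : R) (n : ℕ), X ^ n ∣ U - V →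
      X ^ (n + 1) ∣ P.subst (X * C s * U ^ d) - P.subst (X * C s * V ^ d) := by
    intro P U V s n h
    refine X_pow_dvd_subst_sub_subst P (mul_assoc (X : R⟦X⟧) _ _ ▸ hasSubst_X_mul _)
      (mul_assoc (X : R⟦X⟧) _ _ ▸ hasSubst_X_mul _) ?_
    obtain ⟨q, hq⟩ := h.trans (sub_dvd_pow_sub_pow U V d)
    exact ⟨C s * q, by rw [pow_succ]; linear_combination X * C s * hq⟩
  have key : ∀ n, X ^ n ∣ F - F' ∧ X ^ n ∣ G - G' := by
    intro n
    induction n with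
    | zero => simp
    | succ n ih =>
      constructor
      · rw [hF, hF']; exact step _ _ _ _ _ ih.2
      · rw [hG, hG']; exact step _ _ _ _ _ ih.1
  exact ⟨powerSeries_eq_of_X_pow_dvd fun n => (key n).1,
    powerSeries_eq_of_X_pow_dvd fun n => (key n).2⟩

theorem expand_injective {d : ℕ} (hd : d ≠ 0) : Function.Injective (expand (R := R) d hd) := by
  intro f g h
  ext n
  rw [← coeff_expand_mul d hd f, h, coeff_expand_mul]

/-- Both sides are `f(s x^d H(x^d)^d)`. This turns the variable counting elements into the variable
`x` of the theorem. -/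
theorem expand_rescale_subst {d : ℕ} (hd : d ≠ 0) (s : R) (f H : R⟦X⟧) :
    (expand d hd (rescale s f)).subst (X * expand d hd H)
      = expand d hd (f.subst (X * C s * H ^ d)) := by
  have hX : HasSubst (X * expand d hd H) := hasSubst_X_mul _
  have hXd : HasSubst (X * C s * H ^ d) := mul_assoc (X : R⟦X⟧) _ _ ▸ hasSubst_X_mul _
  have hs : HasSubst (s • X : R⟦X⟧) := HasSubst.smul_X' s
  have hp : HasSubst (X ^ d * expand d hd H ^ d) :=
    HasSubst.of_constantCoeff_zero' (by simp [hd])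
  have hexp : expand d hd (f.subst (X * C s * H ^ d))
      = f.subst (expand d hd (X * C s * H ^ d)) := expand_subst d hd hXd f
  rw [hexp, rescale_eq_subst, expand_apply d hd (subst _ f),
    subst_comp_subst_apply (HasSubst.X_pow hd) hX, subst_pow hX, subst_X hX, mul_pow,
    subst_comp_subst_apply hs hp, subst_smul hp, subst_X hp]
  congr 1
  rw [map_mul, map_mul, expand_X, expand_C, map_pow, smul_eq_C_mul]
  ring

/-! ### Generating functions of trees and the functional equations -/

/-- The generating function of binary trees counted with the weight `w`. -/
def treeGF (w : BinaryTree Unit → R) : R⟦X⟧ := mk fun n => ∑ t ∈ treesOfNumNodesEq n, w t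

theorem sum_treesOfNumNodesEq_succ (w : BinaryTree Unit → R) (n : ℕ) :
    ∑ t ∈ treesOfNumNodesEq (n + 1), w t = ∑ ij ∈ antidiagonal n,
      ∑ l ∈ treesOfNumNodesEq ij.1, ∑ r ∈ treesOfNumNodesEq ij.2, w (node () l r) := by
  rw [treesOfNumNodesEq_succ, sum_biUnion]
  · refine sum_congr rfl fun ij _ => ?_
    rw [sum_map, sum_product]
    rfl
  · intro i _ j _ hij
    refine disjoint_left.2 fun t ht ht' => ?_
    obtain ⟨p, hp, rfl⟩ := mem_map.1 ht
    obtain ⟨q, hq, h⟩ := mem_map.1 ht'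
    simp only [mem_product, mem_treesOfNumNodesEq] at hp hq
    obtain rfl : q = p := Function.Embedding.injective _ h
    exact hij (Prod.ext (hp.1.symm.trans hq.1) (hp.2.symm.trans hq.2))

theorem treeGF_eq_add {w w₁ w₂ w₃ w₄ : BinaryTree Unit → R}
    (h : ∀ l r, w (node () l r) = w₁ l * w₂ r + w₃ l * w₄ r) :
    treeGF w = C (w nil) + X * (treeGF w₁ * treeGF w₂ + treeGF w₃ * treeGF w₄) := by
  ext n
  cases n with
  | zero => simp [treeGF, treesOfNumNodesEq_zero]
  | succ n =>
    rw [map_add, coeff_succ_X_mul, map_add, coeff_mul, coeff_mul, coeff_C, if_neg (by omega),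
      zero_add, ← sum_add_distrib]
    simp only [treeGF, coeff_mk, sum_treesOfNumNodesEq_succ]
    refine sum_congr rfl fun ij _ => ?_
    rw [sum_mul_sum, sum_mul_sum, ← sum_add_distrib]
    refine sum_congr rfl fun l _ => ?_
    rw [← sum_add_distrib]
    exact sum_congr rfl fun r _ => h l r

theorem treeGF_eq {w w₁ w₂ : BinaryTree Unit → R}
    (h : ∀ l r, w (node () l r) = w₁ l * w₂ r) :
    treeGF w = C (w nil) + X * (treeGF w₁ * treeGF w₂) := by
  rw [treeGF_eq_add (w := w) (w₁ := w₁) (w₂ := w₂) (w₃ := 0) (w₄ := 0) (by simp [h])]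
  have : treeGF (0 : BinaryTree Unit → R) = 0 := by ext n; simp [treeGF]
  rw [this, mul_zero, add_zero]

open Classical in
theorem treeGF_ite_eq_nil (r : R) : treeGF (fun t => if t = nil then r else 0) = C r := by
  rw [treeGF_eq (w₁ := 0) (w₂ := 0) (by simp)]
  have : treeGF (0 : BinaryTree Unit → R) = 0 := by ext n; simp [treeGF]
  rw [this]
  simp

section system

variable (α β : ℕ → R)

/-- The weight generating function of noncrossing partitions in which a block of `m` elements has
weight `α m` and a dual block weight `β m`, except that the block of `0` has weight `φ m`. -/
def leftGF (φ : ℕ → R) : R⟦X⟧ :=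
  treeGF fun t => φ (spine t) * openWt α t * blockWt β (mirror t)

/-- The weight generating function of noncrossing partitions in which a block of `m` elements has
weight `α m` and a dual block weight `β m`, except that the dual block of the last element has
weight `φ m`. -/
def rightGF (φ : ℕ → R) : R⟦X⟧ :=
  treeGF fun t => blockWt α t * (φ (spine (mirror t)) * openWt β (mirror t))

variable {α β}

/-- The root lengthens the block of `0` in `l` and the dual block of the last element in `r`; all
other blocks and dual blocks are inherited. -/
theorem leftGF_eq (hβ : β 0 = 1) (φ : ℕ → R) : leftGF α β φ =
    C (φ 0) + X * leftGF α β (fun k => φ (k + 1)) * rightGF α β (fun k => β (k + 1)) := by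
  rw [leftGF, treeGF_eq (w₁ := fun t => φ (spine t + 1) * openWt α t * blockWt β (mirror t))
    (w₂ := fun t => blockWt α t * (β (spine (mirror t) + 1) * openWt β (mirror t)))]
  · simp [spine, openWt, blockWt, mirror, hβ, leftGF, rightGF, mul_assoc]
  · intro l r
    simp only [spine, openWt, blockWt, mirror]
    ring

theorem rightGF_eq (hα : α 0 = 1) (φ : ℕ → R) : rightGF α β φ =
    C (φ 0) + X * rightGF α β (fun k => φ (k + 1)) * leftGF α β (fun k => α (k + 1)) := by
  rw [rightGF, treeGF_eq (w₁ := fun t => α (spine t + 1) * openWt α t * blockWt β (mirror t))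
    (w₂ := fun t => blockWt α t * (φ (spine (mirror t) + 1) * openWt β (mirror t)))]
  · simp only [spine, openWt, blockWt, mirror, hα, leftGF, rightGF, one_mul, mul_one]
    rw [mul_assoc X, mul_comm (treeGF fun t => α _ * _ * _)]
  · intro l r
    simp only [spine, openWt, blockWt, mirror]
    ring

theorem leftGF_eq_subst (hβ : β 0 = 1) (φ : ℕ → R) :
    leftGF α β φ = (mk φ).subst (X * rightGF α β (fun k => β (k + 1))) :=
  eq_of_shift_recursion (D' := fun φ => (mk φ).subst _) (fun φ => C (φ 0)) _ (leftGF_eq hβ)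
    (fun φ => subst_X_mul_mk φ _) φ

theorem rightGF_eq_subst (hα : α 0 = 1) (φ : ℕ → R) :
    rightGF α β φ = (mk φ).subst (X * leftGF α β (fun k => α (k + 1))) :=
  eq_of_shift_recursion (D' := fun φ => (mk φ).subst _) (fun φ => C (φ 0)) _ (rightGF_eq hα)
    (fun φ => subst_X_mul_mk φ _) φ

theorem treeGF_blockWt (hα : α 0 = 1) (hβ : β 0 = 1) :
    treeGF (fun t => blockWt α t * blockWt β (mirror t)) =
      1 + X * (leftGF α β (fun k => α (k + 1)) * rightGF α β (fun k => β (k + 1))) := by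
  have h := leftGF_eq (α := α) hβ α
  rw [hα, map_one, mul_assoc] at h
  exact h

open Classical in
theorem treeGF_firstSingleton (hβ : β 0 = 1) (hα₁ : α 1 = 1) :
    treeGF (fun t => if FirstSingleton t then blockWt α t * blockWt β (mirror t) else 0) =
      X * rightGF α β (fun k => β (k + 1)) := by
  rw [treeGF_eq (w₁ := fun t => if t = nil then 1 else 0)
    (w₂ := fun t => blockWt α t * (β (spine (mirror t) + 1) * openWt β (mirror t)))]
  · simp [FirstSingleton, spine, treeGF_ite_eq_nil, rightGF]
  · intro l r
    by_cases h : l = nil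
    · subst h
      simp [FirstSingleton, spine, openWt, blockWt, mirror, hα₁, hβ]
    · simp [FirstSingleton, spine, spine_eq_zero, h]

open Classical in
theorem treeGF_firstCosingleton (hα : α 0 = 1) (hβ : β 0 = 1) (hβ₁ : β 1 = 1) :
    treeGF (fun t => if FirstCosingleton t then blockWt α t * blockWt β (mirror t) else 0) =
      X * leftGF α β (fun k => α (k + 1)) := by
  -- Passing to the left subtree lengthens the block of `0`, so its weight must be arbitrary for the
  -- recursion to close.
  have key : ∀ φ : ℕ → R, treeGF (fun t => if FirstCosingleton t then
      φ (spine t) * openWt α t * blockWt β (mirror t) else 0) =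
        X * leftGF α β (fun k => φ (k + 1)) := by
    refine eq_of_shift_recursion (fun φ => X * C (φ 1))
      (rightGF α β (fun k => β (k + 1))) (fun φ => ?_) (fun φ => ?_)
    · rw [treeGF_eq_add
        (w₁ := fun t => if t = nil then φ 1 else 0) (w₂ := fun t => if t = nil then 1 else 0)
        (w₃ := fun t => if FirstCosingleton t then
          φ (spine t + 1) * openWt α t * blockWt β (mirror t) else 0)
        (w₄ := fun t => blockWt α t * (β (spine (mirror t) + 1) * openWt β (mirror t)))]
      · simp only [FirstCosingleton, treeGF_ite_eq_nil, rightGF]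
        simp
        ring
      · intro l r
        by_cases hl : l = nil
        · subst hl
          by_cases hr : r = nil
          · subst hr
            simp [FirstCosingleton, spine, openWt, blockWt, mirror, hα, hβ, hβ₁]
          · simp [FirstCosingleton, hr]
        · by_cases hc : FirstCosingleton l
          · simp only [FirstCosingleton, hc, hl, or_true, if_true, if_false, spine, openWt,
              blockWt, mirror]
            ring
          · simp [FirstCosingleton, hl, hc]
    · rw [leftGF_eq hβ]
      ring
  exact key α

end system

end powerSeries

/-! ### Indivisible partitions as a choice of block weights -/

section indivisible

variable {R : Type*} [CommRing R]

/-- The weight of a block of `m` elements: zero if `m` is not `1` modulo `d`, and otherwise with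
one factor `u` for each `d` elements besides the first. -/
def sizeWt (d : ℕ) (a : ℕ → R) (u : R) (m : ℕ) : R :=
  if m = 0 then 1 else if d ∣ m - 1 then a ((m - 1) / d) * u ^ ((m - 1) / d) else 0

theorem sizeWt_zero (d : ℕ) (a : ℕ → R) (u : R) : sizeWt d a u 0 = 1 := if_pos rfl

theorem sizeWt_succ (d : ℕ) (a : ℕ → R) (u : R) (k : ℕ) :
    sizeWt d a u (k + 1) = if d ∣ k then a (k / d) * u ^ (k / d) else 0 := by
  simp [sizeWt]

theorem sizeWt_one (d : ℕ) {a : ℕ → R} (ha : a 0 = 1) (u : R) : sizeWt d a u 1 = 1 := by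
  simp [sizeWt, ha]

theorem mk_sizeWt_succ {d : ℕ} (hd : d ≠ 0) (a : ℕ → R) (u : R) :
    PowerSeries.mk (fun k => sizeWt d a u (k + 1)) =
      PowerSeries.expand d hd (PowerSeries.rescale u (PowerSeries.mk a)) := by
  ext n
  rw [PowerSeries.coeff_mk, sizeWt_succ, PowerSeries.coeff_expand]
  split_ifs
  · rw [PowerSeries.coeff_rescale, PowerSeries.coeff_mk, mul_comm]
  · rfl

theorem modEq_one_iff_dvd_sub_one {d m : ℕ} (hm : 0 < m) : m ≡ 1 [MOD d] ↔ d ∣ m - 1 := by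
  rw [Nat.ModEq.comm, Nat.modEq_iff_dvd' hm]

section parts

variable {n d : ℕ} (π : Finpartition (univ : Finset (Fin n)))

theorem prod_sizeWt_eq_zero (a : ℕ → R) (u : R) (h : ¬ ∀ B ∈ π.parts, #B ≡ 1 [MOD d]) :
    ∏ B ∈ π.parts, sizeWt d a u #B = 0 := by
  push Not at h
  obtain ⟨B, hB, hmod⟩ := h
  have hpos := card_pos.2 (π.nonempty_of_mem_parts hB)
  rw [modEq_one_iff_dvd_sub_one hpos] at hmod
  exact prod_eq_zero hB (by rw [sizeWt, if_neg hpos.ne', if_neg hmod])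

theorem mul_sum_card_sub_one_div (h : ∀ B ∈ π.parts, #B ≡ 1 [MOD d]) :
    d * ∑ B ∈ π.parts, (#B - 1) / d + #π.parts = n := by
  have hsum : ∑ B ∈ π.parts, #B = n := by simpa using π.sum_card_parts
  rw [mul_sum, card_eq_sum_ones, ← sum_add_distrib]
  refine (sum_congr rfl fun B hB => ?_).trans hsum
  have hpos := card_pos.2 (π.nonempty_of_mem_parts hB)
  rw [Nat.mul_div_cancel' ((modEq_one_iff_dvd_sub_one hpos).1 (h B hB))]
  omega

theorem prod_sizeWt (hd : 0 < d) (a : ℕ → R) (u : R) (h : ∀ B ∈ π.parts, #B ≡ 1 [MOD d]) :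
    ∏ B ∈ π.parts, sizeWt d a u #B =
      (∏ B ∈ π.parts, a ((#B - 1) / d)) * u ^ ((n - #π.parts) / d) := by
  have key := mul_sum_card_sub_one_div π h
  have : (n - #π.parts) / d = ∑ B ∈ π.parts, (#B - 1) / d := by
    rw [show n - #π.parts = d * ∑ B ∈ π.parts, (#B - 1) / d by omega,
      Nat.mul_div_cancel_left _ hd]
  rw [this, ← prod_pow_eq_pow_sum, ← prod_mul_distrib]
  refine prod_congr rfl fun B hB => ?_
  have hpos := card_pos.2 (π.nonempty_of_mem_parts hB)
  rw [sizeWt, if_neg hpos.ne', if_pos ((modEq_one_iff_dvd_sub_one hpos).1 (h B hB))]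

end parts

variable {d : ℕ} (a a' : ℕ → R) (s t : R)

/-- The weight of a tree: the weight of the partition that it encodes if this partition is
`d`-indivisible, and zero otherwise. -/
def treeWt (d : ℕ) (a a' : ℕ → R) (s t : R) (T : BinaryTree Unit) : R :=
  blockWt (sizeWt d a t) T * blockWt (sizeWt d a' s) (mirror T)

theorem treeWt_eq (hd : 0 < d) {n : ℕ} {T : BinaryTree Unit} (hT : T.numNodes = n + 1) :
    treeWt d a a' s t T = if treePartition (n + 1) T ∈ NC d (n + 1) then
      wt d a a' s t (treePartition (n + 1) T) else 0 := by
  rw [treeWt, ← prod_parts_treePartition hT _ (sizeWt_zero d a t),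
    ← prod_parts_dual_treePartition hT _ (sizeWt_zero d a' s)]
  have hcard := card_parts_add_card_parts_dual hT
  split_ifs with h
  · rw [NC, mem_filter] at h
    rw [prod_sizeWt _ hd _ _ h.2.2.1, prod_sizeWt _ hd _ _ h.2.2.2, wt,
      -- The count of blocks and dual blocks turns the exponents from `prod_sizeWt` into those of
      -- `wt`.
      show n + 1 - #(treePartition (n + 1) T).parts
        = #(dual (treePartition (n + 1) T)).parts - 1 by omega,
      show n + 1 - #(dual (treePartition (n + 1) T)).parts
        = #(treePartition (n + 1) T).parts - 1 by omega]
    ring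
  · simp only [NC, mem_filter, mem_univ, isNoncrossing_treePartition hT, true_and,
      not_and_or] at h
    rcases h with h | h
    · rw [prod_sizeWt_eq_zero _ _ _ h, zero_mul]
    · rw [prod_sizeWt_eq_zero _ _ _ h, mul_zero]

/-- Adding the size counts for the partition and its dual gives `2 * (n + 1)`; removing the `n + 2`
blocks leaves `n` as a multiple of `d`. -/
theorem dvd_of_treePartition_mem_NC {n : ℕ} {T : BinaryTree Unit} (hT : T.numNodes = n + 1)
    (h : treePartition (n + 1) T ∈ NC d (n + 1)) : d ∣ n := by
  rw [NC, mem_filter] at h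
  have h₁ := mul_sum_card_sub_one_div _ h.2.2.1
  have h₂ := mul_sum_card_sub_one_div _ h.2.2.2
  have hcard := card_parts_add_card_parts_dual hT
  refine ⟨∑ B ∈ (treePartition (n + 1) T).parts, (#B - 1) / d +
    ∑ B ∈ (dual (treePartition (n + 1) T)).parts, (#B - 1) / d, ?_⟩
  rw [mul_add]
  omega

theorem sum_NC_wt (hd : 0 < d) (n : ℕ) (p : Finpartition (univ : Finset (Fin (n + 1))) → Prop)
    [DecidablePred p] (q : BinaryTree Unit → Prop) [DecidablePred q]
    (hpq : ∀ T : BinaryTree Unit, T.numNodes = n + 1 → (p (treePartition (n + 1) T) ↔ q T)) :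
    ∑ π ∈ NC d (n + 1) with p π, wt d a a' s t π =
      ∑ T ∈ treesOfNumNodesEq (n + 1), if q T then treeWt d a a' s t T else 0 := by
  have hfilter : (NC d (n + 1)).filter p = (univ.filter IsNoncrossing).filter
      fun π => p π ∧ π ∈ NC d (n + 1) := by
    ext π
    simp only [NC, mem_filter, mem_univ, true_and]
    tauto
  rw [hfilter, sum_filter, sum_isNoncrossing]
  refine sum_congr rfl fun T hT => ?_
  rw [mem_treesOfNumNodesEq] at hT
  rw [treeWt_eq a a' s t hd hT, ite_and]
  exact if_congr (hpq T hT) rfl rfl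

/-- The generating function of the weights of trees over one variable for each element besides the
first, as a series in the `d`-th power of this variable. -/
theorem eq_expand_mk (hd : 0 < d) {F : PowerSeries R} {f : ℕ → R} {e : R}
    (q : BinaryTree Unit → Prop) [DecidablePred q]
    (hF : treeGF (fun T => if q T then treeWt d a a' s t T else 0) =
      PowerSeries.C e + PowerSeries.X * F)
    (hf : ∀ k, f k =
      ∑ T ∈ treesOfNumNodesEq (d * k + 1), if q T then treeWt d a a' s t T else 0) :
    F = PowerSeries.expand d hd.ne' (PowerSeries.mk f) := by
  have hcoeff : ∀ n, PowerSeries.coeff n F =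
      ∑ T ∈ treesOfNumNodesEq (n + 1), if q T then treeWt d a a' s t T else 0 := by
    intro n
    have := congrArg (PowerSeries.coeff (n + 1)) hF
    rw [map_add, PowerSeries.coeff_succ_X_mul, PowerSeries.coeff_C, if_neg n.succ_ne_zero,
      zero_add] at this
    rw [← this, treeGF, PowerSeries.coeff_mk]
  ext n
  rw [PowerSeries.coeff_expand, hcoeff]
  split_ifs with h
  · obtain ⟨k, rfl⟩ := h
    rw [Nat.mul_div_cancel_left _ hd, PowerSeries.coeff_mk, hf]
  · refine sum_eq_zero fun T hT => ?_
    rw [mem_treesOfNumNodesEq] at hT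
    rw [treeWt_eq a a' s t hd hT, if_neg fun h' => h (dvd_of_treePartition_mem_NC hT h'),
      ite_self]

end indivisible

end IndivisibleNC

/-! ### Proof of the main theorem -/

theorem mainTheorem4 {R : Type*} [CommRing R] (d : ℕ) (hd : 0 < d)
    (a a' : ℕ → R) (ha : a 0 = 1) (ha' : a' 0 = 1) (s t : R)
    (A A' B C C' : PowerSeries R)
    (hA : A = PowerSeries.mk a) (hA' : A' = PowerSeries.mk a')
    (hB : B = PowerSeries.mk (IndivisibleNC.b d a a' s t))
    (hC : C = PowerSeries.mk (IndivisibleNC.c d a a' s t))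
    (hC' : C' = PowerSeries.mk (IndivisibleNC.cStar d a a' s t)) :
    C = A'.subst (PowerSeries.X * PowerSeries.C s * C' ^ d) ∧
    C' = A.subst (PowerSeries.X * PowerSeries.C t * C ^ d) ∧
    B = C * C' ∧
    ∀ F G : PowerSeries R,
      F = A'.subst (PowerSeries.X * PowerSeries.C s * G ^ d) →
      G = A.subst (PowerSeries.X * PowerSeries.C t * F ^ d) →
      F = C ∧ G = C' := by
  classical
  have hα := IndivisibleNC.sizeWt_zero d a t
  have hβ := IndivisibleNC.sizeWt_zero d a' s
  have hα₁ := IndivisibleNC.sizeWt_one d ha t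
  have hβ₁ := IndivisibleNC.sizeWt_one d ha' s
  have hexpC : IndivisibleNC.rightGF (IndivisibleNC.sizeWt d a t) (IndivisibleNC.sizeWt d a' s)
      (fun k => IndivisibleNC.sizeWt d a' s (k + 1)) = PowerSeries.expand d hd.ne' C := by
    rw [hC]
    refine IndivisibleNC.eq_expand_mk a a' s t hd (e := 0) IndivisibleNC.FirstSingleton ?_
      fun k => ?_
    · rw [map_zero, zero_add]
      exact IndivisibleNC.treeGF_firstSingleton hβ hα₁
    · exact IndivisibleNC.sum_NC_wt a a' s t hd _ _ _
        fun T hT => IndivisibleNC.singleton_zero_mem_treePartition hT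
  have hexpC' : IndivisibleNC.leftGF (IndivisibleNC.sizeWt d a t) (IndivisibleNC.sizeWt d a' s)
      (fun k => IndivisibleNC.sizeWt d a t (k + 1)) = PowerSeries.expand d hd.ne' C' := by
    rw [hC']
    refine IndivisibleNC.eq_expand_mk a a' s t hd (e := 0) IndivisibleNC.FirstCosingleton ?_
      fun k => ?_
    · rw [map_zero, zero_add]
      exact IndivisibleNC.treeGF_firstCosingleton hα hβ hβ₁
    · exact IndivisibleNC.sum_NC_wt a a' s t hd _ _ _
        fun T hT => IndivisibleNC.singleton_zero_mem_dual_treePartition hT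
  have hexpB : PowerSeries.expand d hd.ne' C' * PowerSeries.expand d hd.ne' C =
      PowerSeries.expand d hd.ne' B := by
    rw [hB]
    -- Here the empty tree counts with weight `1`; it satisfies neither singleton condition, whence
    -- `e := 0` before.
    refine IndivisibleNC.eq_expand_mk a a' s t hd (e := 1) (fun _ => True) ?_ fun k => ?_
    · simp only [if_true]
      rw [map_one, ← hexpC, ← hexpC']
      exact IndivisibleNC.treeGF_blockWt hα hβ
    · rw [← IndivisibleNC.sum_NC_wt a a' s t hd (d * k) (fun _ => True) _ fun _ _ => Iff.rfl,
        IndivisibleNC.b, Finset.filter_true_of_mem fun _ _ => trivial]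
  have eqC : C = A'.subst (PowerSeries.X * PowerSeries.C s * C' ^ d) := by
    apply IndivisibleNC.expand_injective hd.ne'
    rw [← IndivisibleNC.expand_rescale_subst, hA', ← IndivisibleNC.mk_sizeWt_succ, ← hexpC,
      ← hexpC']
    exact IndivisibleNC.rightGF_eq_subst hα _
  have eqC' : C' = A.subst (PowerSeries.X * PowerSeries.C t * C ^ d) := by
    apply IndivisibleNC.expand_injective hd.ne'
    rw [← IndivisibleNC.expand_rescale_subst, hA, ← IndivisibleNC.mk_sizeWt_succ, ← hexpC,
      ← hexpC']
    exact IndivisibleNC.leftGF_eq_subst hβ _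
  refine ⟨eqC, eqC', ?_, fun F G hF hG =>
    IndivisibleNC.eq_of_subst_system s t d hF hG eqC eqC'⟩
  apply IndivisibleNC.expand_injective hd.ne'
  rw [← hexpB, map_mul, mul_comm]
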